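/- Let $R$ be an associative unital ring; a complex means a $\mathbb{Z}$-indexed (unbounded) complex of left $R$-modules. A complex $M$ is acyclic if its homology vanishes, and contractible if its identity map is null-homotopic. A short exact sequence of $R$-modules is pure if it remains exact under $\operatorname{Hom}_R(A,-)$ for every finitely presented $R$-module $A$; a short exact sequence of complexes is pure if it remains exact under the group of chain maps $\operatorname{Hom}_{\mathcal C(R)}(A,-)$ for every bounded complex $A$ of finitely presented $R$-modules. A subcomplex $L\subseteq M$ is pure if $0\to L\to M\to M/L\to 0$ is pure, and split if $L$ is a direct summand of $M$ as a complex. A complex $M$ is pure-acyclic if it is acyclic and each sequence $0\to Z_i(M)\to M_i\to Z_{i-1}(M)\to 0$ is pure, where $Z_i(M)$ is the module of cycles in degree $i$. A complex $I$ is semi-injective if each $I_i$ is an injective $R$-module and the total Hom complex $\operatorname{Hom}_R(A,I)$ is acyclic for every acyclic complex $A$. **Proposition.** Let $I$ be a semi-injective complex of $R$-modules. The following conditions are equivalent: 1. $I$ is minimal: every homotopy equivalence $I\to I$ is an isomorphism. 2. $I$ is split-minimal: the zero complex is the only contractible split subcomplex of $I$. 3. $I$ is pure-minimal: the zero complex is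 the only pure-acyclic pure subcomplex of $I$. 4. The zero complex is the only acyclic subcomplex of $I$. -/

import Mathlib

open CategoryTheory CategoryTheory.Limits Opposite

noncomputable section

namespace PureMin

universe u

/-- Complexes of left modules over the associative unital ring `R`, unbounded and indexed by `ℤ`.
Mathlib's cohomological indexing is used: the module in homological degree `i` is `M.X (-i)`. -/
abbrev Cpx (R : Type u) [Ring R] := CochainComplex (ModuleCat.{u} R) ℤ

variable {R : Type u} [Ring R]

/-- A sequence `0 → L → M → N → 0` of modules is pure exact: it is exact, and it stays exact under
`Hom(A, -)` for every finitely presented module `A`. -/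
def IsPureExact (S : ShortComplex (ModuleCat.{u} R)) : Prop :=
  S.ShortExact ∧ ∀ A : ModuleCat.{u} R, Module.FinitePresentation R A →
    (S.map (preadditiveCoyoneda.obj (op A))).ShortExact

/-- A bounded complex of finitely presented modules. -/
def IsBoundedFinitelyPresented (A : Cpx R) : Prop :=
  (∃ a b : ℤ, A.IsStrictlyGE a ∧ A.IsStrictlyLE b) ∧
    ∀ i : ℤ, Module.FinitePresentation R (A.X i)

/-- A sequence `0 → L → M → N → 0` of complexes is pure exact: it is exact, and it stays exact
under the groups of chain maps out of `A`, for every bounded complex `A` of finitely presented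
modules. -/
def IsPureExactCpx (S : ShortComplex (Cpx R)) : Prop :=
  S.ShortExact ∧ ∀ A : Cpx R, IsBoundedFinitelyPresented A →
    (S.map (preadditiveCoyoneda.obj (op A))).ShortExact

/-- The canonical sequence `0 → L → M → M/L → 0` of a subcomplex `L` of `M`. -/
def quotientSequence {L M : Cpx R} (f : L ⟶ M) : ShortComplex (Cpx R) :=
  ShortComplex.mk f (cokernel.π f) (cokernel.condition f)

/-- The sequence `Zⁱ(M) → Mⁱ → Zⁱ⁺¹(M)` whose second map is induced by the differential. -/
def cyclesSequence (M : Cpx R) (i : ℤ) : ShortComplex (ModuleCat.{u} R) :=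
  ShortComplex.mk (M.iCycles i) (M.toCycles i (i + 1)) (by
    rw [← cancel_mono (M.iCycles (i + 1))]
    simp)

/-- Pure-acyclic complexes. -/
def IsPureAcyclic (M : Cpx R) : Prop :=
  M.Acyclic ∧ ∀ i : ℤ, IsPureExact (cyclesSequence M i)

/-- Contractible complexes: the identity is null-homotopic. -/
def IsContractible (M : Cpx R) : Prop :=
  Nonempty (Homotopy (𝟙 M) 0)

/-- Semi-injective complexes: complexes of injective modules such that the total Hom complex
`Hom(A, I)` is acyclic for every acyclic complex `A`. -/
def IsSemiInjective (I : Cpx R) : Prop :=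
  (∀ i : ℤ, Module.Injective R (I.X i)) ∧
    ∀ A : Cpx R, A.Acyclic → (CochainComplex.HomComplex A I).Acyclic

/-- Minimal complexes: every homotopy equivalence `M → M` is an isomorphism. -/
def IsMinimal (M : Cpx R) : Prop :=
  ∀ e : HomotopyEquiv M M, IsIso e.hom

/-- Split-minimal complexes: the zero complex is the only contractible split subcomplex, that is,
the only contractible direct summand. -/
def IsSplitMinimal (M : Cpx R) : Prop :=
  ∀ (L : Cpx R) (f : L ⟶ M), IsSplitMono f → IsContractible L → IsZero L

/-- Pure-minimal complexes: the zero complex is the only pure-acyclic pure subcomplex. -/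
def IsPureMinimal (M : Cpx R) : Prop :=
  ∀ (L : Cpx R) (f : L ⟶ M), Mono f → IsPureExactCpx (quotientSequence f) →
    IsPureAcyclic L → IsZero L

/-- The zero complex is the only acyclic subcomplex of `M`. -/
def HasOnlyZeroAcyclicSubcomplex (M : Cpx R) : Prop :=
  ∀ (L : Cpx R) (f : L ⟶ M), Mono f → L.Acyclic → IsZero L

end PureMin

end

/-! The bridge is `HasEssentialCycles`: cocycles are essential in each degree. Split-minimality
implies it: enlarge N disjoint from the cocycles to a maximal such E, a direct summand by
injectivity. As d is injective on E, the complex E = E embeds in I, and it splits off, being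
contractible with injective terms. So E = 0. Essential cocycles make every endomorphism homotopic to
the identity injective, then invertible, hence I minimal. If I is minimal and L ⊆ I is acyclic, the
inclusion is null-homotopic; extending the homotopy to I gives an automorphism homotopic to the
identity that kills L. The remaining implications hold because contractible complexes are
pure-acyclic and split subcomplexes are pure. -/

open CategoryTheory CategoryTheory.Limits Opposite

noncomputable section

namespace PureMin

universe u

/-! ### Maximal submodules disjoint from a given one -/

section Modules

variable {R M : Type u} [Ring R] [AddCommGroup M] [Module R M]

/-- Every submodule disjoint from `Z` is contained in a maximal one. -/
theorem exists_maximal_disjoint (Z N : Submodule R M) (hN : Disjoint N Z) :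
    ∃ E, N ≤ E ∧ Maximal (fun E : Submodule R M => Disjoint E Z) E := by
  refine zorn_le_nonempty₀ {E : Submodule R M | Disjoint E Z} (fun c hc hchain _ _ => ?_) N hN
  refine ⟨sSup c, ?_, fun N hN => le_sSup hN⟩
  change Disjoint (sSup c) Z
  rw [DirectedOn.disjoint_sSup_left hchain.directedOn]
  exact fun b hb => hc hb

/-- A submodule that is maximal among those meeting `Z` trivially is a retract of the ambient
injective module. -/
theorem exists_retraction_of_maximal_disjoint (hM : Module.Injective R M) (Z E : Submodule R M)
    (hE : Maximal (fun N : Submodule R M => Disjoint N Z) E) :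
    ∃ r : M →ₗ[R] E, ∀ x : E, r x = x := by
  obtain ⟨C, -, hC⟩ := exists_maximal_disjoint E ⊥ disjoint_bot_left
  have hinj : Function.Injective (C.mkQ ∘ₗ E.subtype) := by
    rw [← LinearMap.ker_eq_bot, LinearMap.ker_eq_bot']
    intro x hx
    have hxC : (x : M) ∈ C := by simpa using hx
    exact Subtype.ext (Submodule.disjoint_def.1 hC.prop x hxC x.2)
  obtain ⟨g, hg⟩ := hM.out _ hinj E.subtype
  have hgE : ∀ x : E, g (C.mkQ x) = x := fun x => hg x
  -- If `g` sends the class of m to a nonzero z in `Z`, any c + a • m in `E` equals a • z, so lies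
  -- in `Z` and vanishes: C + Rm is still disjoint from `E`.
  have hdisj : Disjoint (LinearMap.range (g ∘ₗ C.mkQ)) Z := by
    rw [Submodule.disjoint_def]
    rintro _ ⟨m, rfl⟩ hz
    by_contra hne
    have hmC : m ∉ C := fun hm => hne (by simp [(Submodule.Quotient.mk_eq_zero C).2 hm])
    have hlt : C < C ⊔ Submodule.span R {m} := by
      rw [left_lt_sup, Submodule.span_singleton_le_iff_mem]
      exact hmC
    refine hC.not_prop_of_gt hlt (Submodule.disjoint_def.2 ?_)
    intro x hx hxE
    obtain ⟨c, hc, y, hy, rfl⟩ := Submodule.mem_sup.1 hx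
    obtain ⟨a, rfl⟩ := Submodule.mem_span_singleton.1 hy
    refine Submodule.disjoint_def.1 hE.prop _ hxE ?_
    have hx' : c + a • m = g (C.mkQ (c + a • m)) := (hgE ⟨_, hxE⟩).symm
    rw [hx']
    have : C.mkQ (c + a • m) = a • C.mkQ m := by
      rw [map_add, map_smul, Submodule.mkQ_apply, (Submodule.Quotient.mk_eq_zero C).2 hc, zero_add]
    rw [this, map_smul]
    exact Z.smul_mem a hz
  have hle : E ≤ LinearMap.range (g ∘ₗ C.mkQ) := fun x hx => ⟨x, hgE ⟨x, hx⟩⟩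
  have hrange : LinearMap.range (g ∘ₗ C.mkQ) ≤ E := hE.2 hdisj hle
  exact ⟨(g ∘ₗ C.mkQ).codRestrict E fun m => hrange ⟨m, rfl⟩, fun x => Subtype.ext (hgE x)⟩

end Modules

section Homotopy

variable {V ι : Type*} [Category V] [Preadditive V] {c : ComplexShape ι}

/-- Null-homotopies into a complex of injective objects extend along degreewise
monomorphisms. -/
theorem exists_comp_nullHomotopicMap_eq {K L M : HomologicalComplex V c} (f : K ⟶ L)
    (hf : ∀ i, Mono (f.f i)) (hM : ∀ i, Injective (M.X i)) {g : K ⟶ M} (h : Homotopy g 0) :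
    ∃ p : L ⟶ M, f ≫ p = g ∧ Nonempty (Homotopy p 0) := by
  classical
  let s : ∀ i j, c.Rel j i → (L.X i ⟶ M.X j) := fun i j _ =>
    haveI := hf i; haveI := hM j; Injective.factorThru (h.hom i j) (f.f i)
  refine ⟨Homotopy.nullHomotopicMap' s, ?_, ⟨Homotopy.nullHomotopy' s⟩⟩
  rw [Homotopy.comp_nullHomotopicMap']
  have hs : ∀ i j hij, f.f i ≫ s i j hij = h.hom i j := fun i j _ =>
    haveI := hf i; haveI := hM j; Injective.comp_factorThru _ _
  simp only [hs]
  ext i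
  have := h.comm i
  rw [HomologicalComplex.zero_f, add_zero] at this
  rw [this, Homotopy.nullHomotopicMap', Homotopy.nullHomotopicMap]
  have hh : (fun i j => if hij : c.Rel j i then h.hom i j else 0) = h.hom := by
    ext i j
    split_ifs with hij
    · rfl
    · rw [h.zero i j hij]
  dsimp only
  rw [hh]

end Homotopy

/-! ### Minimality and essential cocycles -/

variable {R : Type u} [Ring R]

theorem injective_X_of_module_injective {I : Cpx R} (hI : ∀ i : ℤ, Module.Injective R (I.X i))
    (i : ℤ) : Injective (I.X i) :=
  Module.injective_object_of_injective_module (inj := hI i)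

/-- A chain map is a 0-cocycle of the Hom complex; a cochain bounding it is a null-homotopy. -/
theorem homotopyZero_of_isSemiInjective {L I : Cpx R} (hI : IsSemiInjective I) (hL : L.Acyclic)
    (f : L ⟶ I) : Nonempty (Homotopy f 0) := by
  have h := hI.2 L hL 0
  rw [HomologicalComplex.exactAt_iff' _ (-1) 0 1 (by simp) (by simp),
    ShortComplex.ab_exact_iff] at h
  obtain ⟨z, hz⟩ := h (CochainComplex.HomComplex.Cochain.ofHom f) (by
    exact CochainComplex.HomComplex.δ_ofHom f)
  refine ⟨(CochainComplex.HomComplex.Cochain.equivHomotopy f 0).symm ⟨z, ?_⟩⟩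
  rw [CochainComplex.HomComplex.Cochain.ofHom_zero, add_zero]
  exact hz.symm

theorem acyclic_of_isContractible {L : Cpx R} (hL : IsContractible L) : L.Acyclic := by
  intro i
  obtain ⟨h⟩ := hL
  rw [HomologicalComplex.exactAt_iff_isZero_homology, IsZero.iff_id_eq_zero]
  simpa using h.homologyMap_eq i

/-- The cocycles form an essential submodule of the complex in each
degree. -/
def HasEssentialCycles (I : Cpx R) : Prop :=
  ∀ i j : ℤ, (ComplexShape.up ℤ).Rel i j → ∀ N : Submodule R (I.X i),
    Disjoint N (LinearMap.ker (I.d i j).hom) → N = ⊥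

theorem hasOnlyZeroAcyclicSubcomplex_of_isMinimal {I : Cpx R} (hI : IsSemiInjective I) (h : IsMinimal I) :
    HasOnlyZeroAcyclicSubcomplex I := by
  intro L f hf hL
  -- The sign makes `p + 𝟙 I` vanish on `L`.
  obtain ⟨s⟩ := homotopyZero_of_isSemiInjective hI hL (-f)
  obtain ⟨p, hp, ⟨t⟩⟩ := exists_comp_nullHomotopicMap_eq f (fun i => inferInstance)
    (injective_X_of_module_injective hI.1) s
  have q : Homotopy (p + 𝟙 I) (𝟙 I) :=
    (t.add (Homotopy.refl _)).trans (Homotopy.ofEq (zero_add _))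
  let e : HomotopyEquiv I I :=
    { hom := p + 𝟙 I
      inv := 𝟙 I
      homotopyHomInvId := (Homotopy.ofEq (Category.comp_id _)).trans q
      homotopyInvHomId := (Homotopy.ofEq (Category.id_comp _)).trans q }
  have := h e
  have hz : f ≫ e.hom = 0 := by simp [e, hp]
  rw [IsZero.iff_id_eq_zero, ← cancel_mono f, ← cancel_mono e.hom]
  simp [hz]

theorem mono_f_of_homotopy_id {I : Cpx R} (hI : HasEssentialCycles I) {g : I ⟶ I}
    (h : Homotopy g (𝟙 I)) (i : ℤ) : Mono (g.f i) := by
  have key : ∀ x : I.X i, g.f i x = h.hom (i + 1) i (I.d i (i + 1) x) +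
      I.d (i - 1) i (h.hom i (i - 1) x) + x := by
    intro x
    have := h.comm i
    rw [dNext_eq _ (show (ComplexShape.up ℤ).Rel i (i + 1) by simp),
      prevD_eq _ (show (ComplexShape.up ℤ).Rel (i - 1) i by simp)] at this
    rw [this]
    rfl
  have hdd : ∀ x, I.d i (i + 1) (I.d (i - 1) i x) = 0 := fun x => by
    rw [← ConcreteCategory.comp_apply, I.d_comp_d]; rfl
  rw [ModuleCat.mono_iff_ker_eq_bot]
  refine hI i (i + 1) (by simp) _ ?_
  set K := LinearMap.ker (g.f i).hom ⊓ LinearMap.ker (I.d i (i + 1)).hom with hK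
  have hx : ∀ x ∈ K, I.d (i - 1) i (h.hom i (i - 1) x) = - x := by
    rintro x ⟨hx₁, hx₂⟩
    have hx₁ : g.f i x = 0 := hx₁
    have hx₂ : I.d i (i + 1) x = 0 := hx₂
    have := key x
    rw [hx₁, hx₂, map_zero, zero_add] at this
    exact eq_neg_of_add_eq_zero_left this.symm
  -- On `K` one has d h x = -x, so a cocycle h x forces x = 0; essentiality one degree lower then
  -- kills h(K).
  have hmap : K.map (h.hom i (i - 1)).hom = ⊥ := by
    refine hI (i - 1) i (by simp) _ (Submodule.disjoint_def.2 ?_)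
    rintro _ ⟨x, hxK, rfl⟩ hd
    have hd : I.d (i - 1) i (h.hom i (i - 1) x) = 0 := hd
    rw [hx x hxK, neg_eq_zero] at hd
    rw [hd, map_zero]
  rw [disjoint_iff, eq_bot_iff]
  intro x hxK
  have h0 : h.hom i (i - 1) x = 0 := by
    have : (h.hom i (i - 1)).hom x ∈ K.map (h.hom i (i - 1)).hom := ⟨x, hxK, rfl⟩
    rw [hmap] at this
    exact this
  have := hx x hxK
  rw [h0, map_zero] at this
  exact neg_eq_zero.1 this.symm

/-- Extending the null-homotopy of 1 - g along the mono g gives a left inverse of g. It too is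
homotopic to the identity, hence mono, so it is two-sided. -/
theorem isIso_of_homotopy_id {I : Cpx R} (hinj : ∀ i, Injective (I.X i))
    (hI : HasEssentialCycles I) {g : I ⟶ I} (h : Homotopy g (𝟙 I)) : IsIso g := by
  have h' : Homotopy (𝟙 I - g) 0 := Homotopy.equivSubZero h.symm
  obtain ⟨p, hp, ⟨t⟩⟩ := exists_comp_nullHomotopicMap_eq g (mono_f_of_homotopy_id hI h) hinj h'
  have hr : Homotopy (p + 𝟙 I) (𝟙 I) := (t.add (Homotopy.refl _)).trans (Homotopy.ofEq (by simp))
  have hgr : g ≫ (p + 𝟙 I) = 𝟙 I := by simp [hp]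
  have : Mono (p + 𝟙 I) := by
    have := mono_f_of_homotopy_id hI hr
    exact HomologicalComplex.mono_of_mono_f _ this
  refine ⟨p + 𝟙 I, hgr, ?_⟩
  rw [← cancel_mono (p + 𝟙 I), Category.assoc, hgr, Category.comp_id, Category.id_comp]

theorem isMinimal_of_hasEssentialCycles {I : Cpx R} (hinj : ∀ i, Injective (I.X i))
    (hI : HasEssentialCycles I) : IsMinimal I := by
  intro e
  have h₁ := isIso_of_homotopy_id hinj hI e.homotopyHomInvId
  have h₂ := isIso_of_homotopy_id hinj hI e.homotopyInvHomId
  have : Mono e.hom := mono_of_mono e.hom e.inv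
  have : IsSplitEpi e.hom := ⟨⟨⟨inv (e.inv ≫ e.hom) ≫ e.inv, by simp⟩⟩⟩
  exact isIso_of_mono_of_isSplitEpi e.hom

/-- The two-term complex of an isomorphism is contractible. -/
theorem isContractible_double_id (E : ModuleCat.{u} R) {i j : ℤ}
    (hij : (ComplexShape.up ℤ).Rel i j) (hne : i ≠ j) :
    IsContractible (HomologicalComplex.double (𝟙 E) hij) := by
  let D := HomologicalComplex.double (𝟙 E) hij
  let s : ∀ k l, (ComplexShape.up ℤ).Rel l k → (D.X k ⟶ D.X l) := fun k l _ =>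
    if h : k = j ∧ l = i then
      (D.XIsoOfEq h.1).hom ≫ (HomologicalComplex.doubleXIso₁ (𝟙 E) hij hne).hom ≫
        (HomologicalComplex.doubleXIso₀ (𝟙 E) hij).inv ≫ (D.XIsoOfEq h.2).inv
    else 0
  have hs : s j i hij = (HomologicalComplex.doubleXIso₁ (𝟙 E) hij hne).hom ≫
      (HomologicalComplex.doubleXIso₀ (𝟙 E) hij).inv := by
    simp only [s, and_self, dite_true, HomologicalComplex.XIsoOfEq_rfl, Iso.refl_hom, Iso.refl_inv,
      Category.id_comp]
    erw [Category.comp_id]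
  have hid : 𝟙 D = Homotopy.nullHomotopicMap' s := by
    have hj : (ComplexShape.up ℤ).Rel j (j + 1) := by simp
    have hi : (ComplexShape.up ℤ).Rel (i - 1) i := by simp
    apply HomologicalComplex.from_double_hom_ext
    · rw [Homotopy.nullHomotopicMap'_f hi hij, hs, HomologicalComplex.double_d _ _ hne,
        HomologicalComplex.double_d_eq_zero₀ _ _ _ _ (by lia)]
      simp [D]
    · rw [Homotopy.nullHomotopicMap'_f hij hj, hs, HomologicalComplex.double_d _ _ hne,
        HomologicalComplex.double_d_eq_zero₀ _ _ _ _ hne.symm]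
      simp [D]
  exact ⟨(Homotopy.ofEq hid).trans (Homotopy.nullHomotopy' s)⟩

theorem injective_double_X {E : ModuleCat.{u} R} (hE : Injective E) {i j : ℤ}
    (hij : (ComplexShape.up ℤ).Rel i j) (hne : i ≠ j) (k : ℤ) :
    Injective ((HomologicalComplex.double (𝟙 E) hij).X k) := by
  by_cases hi : k = i
  · subst hi
    exact Injective.of_iso (HomologicalComplex.doubleXIso₀ (𝟙 E) hij).symm hE
  by_cases hj : k = j
  · subst hj
    exact Injective.of_iso (HomologicalComplex.doubleXIso₁ (𝟙 E) hij hne).symm hE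
  · exact (HomologicalComplex.isZero_double_X _ hij k hi hj).injective

theorem hasEssentialCycles_of_isSplitMinimal {I : Cpx R}
    (hinj : ∀ i : ℤ, Module.Injective R (I.X i)) (h : IsSplitMinimal I) :
    HasEssentialCycles I := by
  rintro i j hij N hN
  obtain ⟨E, hNE, hE⟩ := exists_maximal_disjoint _ N hN
  obtain ⟨r, hr⟩ := exists_retraction_of_maximal_disjoint (hinj i) _ E hE
  have hne : i ≠ j := by
    have : i + 1 = j := hij
    lia
  let ι : ModuleCat.of R E ⟶ I.X i := ModuleCat.ofHom E.subtype
  have hιr : ι ≫ ModuleCat.ofHom r = 𝟙 _ := by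
    ext x
    exact congrArg Subtype.val (hr x)
  have := injective_X_of_module_injective hinj i
  have hEinj : Injective (ModuleCat.of R E) :=
    (Retract.mk ι (ModuleCat.ofHom r) hιr).injective
  have hι : Mono ι := mono_of_mono_fac hιr
  have hιd : Mono (ι ≫ I.d i j) := by
    rw [ModuleCat.mono_iff_ker_eq_bot, LinearMap.ker_eq_bot']
    intro x hx
    exact Subtype.ext (Submodule.disjoint_def.1 hE.prop x x.2 hx)
  let D := HomologicalComplex.double (𝟙 (ModuleCat.of R E)) hij
  let f : D ⟶ I := HomologicalComplex.mkHomFromDouble _ hne ι (ι ≫ I.d i j) (by simp) (by simp)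
  have hf : ∀ k, Mono (f.f k) := by
    intro k
    by_cases hi : k = i
    · subst hi
      dsimp only [f]
      rw [HomologicalComplex.mkHomFromDouble_f₀]
      exact mono_comp _ _
    by_cases hj : k = j
    · subst hj
      dsimp only [f]
      rw [HomologicalComplex.mkHomFromDouble_f₁]
      exact mono_comp _ _
    · exact ⟨fun _ _ _ => (HomologicalComplex.isZero_double_X _ _ k hi hj).eq_of_tgt _ _⟩
  have hD : IsContractible D := isContractible_double_id _ hij hne
  obtain ⟨s⟩ := id hD
  -- Extending the null-homotopic identity of `D` along `f` gives a retraction.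
  obtain ⟨p, hp, -⟩ := exists_comp_nullHomotopicMap_eq f hf (injective_double_X hEinj hij hne) s
  have hzero : IsZero D := h D f ⟨⟨⟨p, hp⟩⟩⟩ hD
  have hzE : IsZero (ModuleCat.of R E) :=
    ((HomologicalComplex.eval _ _ i).map_isZero hzero).of_iso
      (HomologicalComplex.doubleXIso₀ (𝟙 (ModuleCat.of R E)) hij).symm
  have := ModuleCat.subsingleton_of_isZero hzE
  rw [eq_bot_iff]
  intro x hx
  exact congrArg Subtype.val (Subsingleton.elim (⟨x, hNE hx⟩ : E) 0)

/-! ### Purity from splittings -/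

theorem isPureExact_of_splitting {S : ShortComplex (ModuleCat.{u} R)} (s : S.Splitting) :
    IsPureExact S :=
  ⟨s.shortExact, fun A _ => (s.map (preadditiveCoyoneda.obj (op A))).shortExact⟩

theorem isPureExactCpx_of_splitting {S : ShortComplex (Cpx R)} (s : S.Splitting) :
    IsPureExactCpx S :=
  ⟨s.shortExact, fun A _ => (s.map (preadditiveCoyoneda.obj (op A))).shortExact⟩

theorem isPureExactCpx_quotientSequence {L M : Cpx R} (f : L ⟶ M) (hf : IsSplitMono f) :
    IsPureExactCpx (quotientSequence f) :=
  isPureExactCpx_of_splitting <|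
    ShortComplex.Splitting.ofExactOfRetraction _ (ShortComplex.exact_cokernel f)
      hf.exists_splitMono.some.retraction hf.exists_splitMono.some.id
      (inferInstanceAs (Epi (cokernel.π f)))

/-- The contraction splits every cycle sequence. -/
theorem isPureAcyclic_of_isContractible {L : Cpx R} (hL : IsContractible L) :
    IsPureAcyclic L := by
  refine ⟨acyclic_of_isContractible hL, fun i => ?_⟩
  obtain ⟨h⟩ := hL
  have key : ∀ k, 𝟙 (L.X k) = L.d k (k + 1) ≫ h.hom (k + 1) k +
      h.hom k (k - 1) ≫ L.d (k - 1) k := by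
    intro k
    have := h.comm k
    rwa [dNext_eq _ (show (ComplexShape.up ℤ).Rel k (k + 1) by simp),
      prevD_eq _ (show (ComplexShape.up ℤ).Rel (k - 1) k by simp), HomologicalComplex.zero_f,
      add_zero] at this
  -- Stated apart because `key (i + 1)` passes through degree `i + 1 - 1` rather than `i`.
  have key' : 𝟙 (L.X (i + 1)) = L.d (i + 1) (i + 1 + 1) ≫ h.hom (i + 1 + 1) (i + 1) +
      h.hom (i + 1) i ≫ L.d i (i + 1) := by
    have := h.comm (i + 1)
    rwa [dNext_eq _ (show (ComplexShape.up ℤ).Rel (i + 1) (i + 1 + 1) by simp),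
      prevD_eq _ (show (ComplexShape.up ℤ).Rel i (i + 1) by simp), HomologicalComplex.zero_f,
      add_zero] at this
  have h₁ : L.iCycles i ≫ h.hom i (i - 1) ≫ L.toCycles (i - 1) i = 𝟙 _ := by
    rw [← cancel_mono (L.iCycles i)]
    have := L.iCycles i ≫= key i
    simpa using this.symm
  have h₂ : (L.iCycles (i + 1) ≫ h.hom (i + 1) i) ≫ L.toCycles i (i + 1) = 𝟙 _ := by
    rw [← cancel_mono (L.iCycles (i + 1))]
    have := L.iCycles (i + 1) ≫= key'
    simpa using this.symm
  have h₃ : (h.hom i (i - 1) ≫ L.toCycles (i - 1) i) ≫ L.iCycles i +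
      L.toCycles i (i + 1) ≫ L.iCycles (i + 1) ≫ h.hom (i + 1) i = 𝟙 _ := by
    rw [Category.assoc, HomologicalComplex.toCycles_i, HomologicalComplex.toCycles_i_assoc,
      add_comm (h.hom i (i - 1) ≫ _)]
    exact (key i).symm
  exact isPureExact_of_splitting
    { r := h.hom i (i - 1) ≫ L.toCycles (i - 1) i
      s := L.iCycles (i + 1) ≫ h.hom (i + 1) i
      f_r := h₁
      s_g := h₂
      id := h₃ }

end PureMin

end

theorem mainTheorem10 {R : Type*} [Ring R] (I : PureMin.Cpx R) (hI : PureMin.IsSemiInjective I) :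
    List.TFAE [PureMin.IsMinimal I, PureMin.IsSplitMinimal I, PureMin.IsPureMinimal I,
      PureMin.HasOnlyZeroAcyclicSubcomplex I] := by
  tfae_have 1 → 4 := PureMin.hasOnlyZeroAcyclicSubcomplex_of_isMinimal hI
  tfae_have 4 → 3 := fun h L f hf _ hL => h L f hf hL.1
  tfae_have 3 → 2 := fun h L f hf hL => h L f inferInstance
    (PureMin.isPureExactCpx_quotientSequence f hf) (PureMin.isPureAcyclic_of_isContractible hL)
  tfae_have 2 → 1 := fun h => PureMin.isMinimal_of_hasEssentialCycles
    (PureMin.injective_X_of_module_injective hI.1)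
    (PureMin.hasEssentialCycles_of_isSplitMinimal hI.1 h)
  tfae_finish
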